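/- Consider the following game of online binary prediction with abstentions, with $N$ experts, $T$ rounds and abstention cost $c$. In each round $t=1,\dots,T$ the learner observes the predictions $y_{t,1},\dots,y_{t,N}\in\{0,1\}$ of the experts and then, based on everything observed so far (the expert predictions of rounds $1,\dots,t$ and the labels $y_1,\dots,y_{t-1}$) and on internal randomness, chooses $\widehat y_t\in\{0,*,1\}$; then the environment reveals $y_t\in\{0,1\}$. The learner's loss is $\widehat\ell_t=\mathbf 1\{\widehat y_t\ne y_t\}$ if $\widehat y_t\in\{0,1\}$ and $\widehat\ell_t=c$ if $\widehat y_t=*$ (abstention); expert $i$ has loss $\ell_{t,i}=\mathbf 1\{y_{t,i}\neq y_t\}$. The expected regret is \[ R_T=\max_{1\le i\le N}\mathbb E\Big[\sum_{t=1}^T\big(\widehat\ell_t-\ell_{t,i}\big)\Big], \] where the expectation is over the internal randomness of the learner. Theorem. There is an absolute constant $C>0$ such that for all $c\in[\tfrac14,\tfrac12]$ and all integers $N\ge 2$ and $T\ge 4\log N$ the following holds. There are $N$ distinct experts, given by fixed prediction sequences $(y_{t,i})_{t=1}^T\in\{0,1\}^T$, $i=1,\dots,N$, such that for every randomized prediction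 strategy with abstentions there is a label sequence $(y_t)_{t=1}^T\in\{0,1\}^T$ of the environment (which may depend on the strategy but not on the learner's random bits) for which \[ R_T\ \ge\ C\,\min\Big\{\frac{\log N}{1-2c},\ \sqrt{T\log N}\Big\}, \] where $\frac{\log N}{1-2c}$ is read as $+\infty$ when $c=\tfrac12$. -/

import Mathlib

open MeasureTheory

namespace AbstentionGame

/-- The possible actions of the learner: predict a binary label (`false` is `0`, `true` is `1`),
or abstain (written `*` in the usual notation). -/
inductive Action : Type
  | label (b : Bool)
  | abstain

instance : MeasurableSpace Action := ⊤

/-- The binary loss of a prediction `b` (of an expert, say) when the true label is `y`. -/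
def binaryLoss (b y : Bool) : ℝ := if b = y then 0 else 1

/-- The loss of the learner when abstaining costs `c`. -/
def learnerLoss (c : ℝ) : Action → Bool → ℝ
  | Action.label b, y => binaryLoss b y
  | Action.abstain, _ => c

/-- A randomized online prediction strategy with abstentions, for `N` experts and `T` rounds,
with internal randomness drawn from `Ω`. In round `t` the action may depend on the predictions
of all experts in the rounds up to and including `t`, on the true labels of the rounds strictly
before `t`, and on the random seed `ω`. The seed is shared by all rounds, so the actions of
different rounds may be dependent in an arbitrary way (in particular the learner
may use its own past actions). -/
structure RandomizedStrategy (N T : ℕ) (Ω : Type*) [MeasurableSpace Ω] where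
  act (t : Fin T) (advice : Set.Iic t → Fin N → Bool) (past : Set.Iio t → Bool) (ω : Ω) : Action
  measurable_act (t : Fin T) (advice : Set.Iic t → Fin N → Bool) (past : Set.Iio t → Bool) :
    Measurable (act t advice past)

/-- The action taken in round `t` with seed `ω`, when expert `i` predicts `experts i s` in round
`s` and the true label of round `s` is `y s`. -/
def RandomizedStrategy.play {N T : ℕ} {Ω : Type*} [MeasurableSpace Ω]
    (S : RandomizedStrategy N T Ω) (experts : Fin N → Fin T → Bool) (y : Fin T → Bool)
    (t : Fin T) (ω : Ω) : Action :=
  S.act t (fun s i => experts i s) (fun s => y s) ω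

/-- The expected regret: the maximum over the experts `i` of the expectation (over the randomness
of the learner) of the total loss of the learner minus the total loss of expert `i`. -/
noncomputable def expectedRegret {N T : ℕ} {Ω : Type*} [MeasurableSpace Ω] (P : Measure Ω)
    (c : ℝ) (experts : Fin N → Fin T → Bool) (S : RandomizedStrategy N T Ω)
    (y : Fin T → Bool) : ℝ :=
  ⨆ i : Fin N,
    ∫ ω, ∑ t, (learnerLoss c (S.play experts y t ω) (y t) - binaryLoss (experts i t) (y t)) ∂P

/-- The rate `min (log N / (1 - 2c)) √(T log N)`, where `log N / (1 - 2c)` is read as `+∞`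
for `c = 1/2`. -/
noncomputable def rate (c : ℝ) (N T : ℕ) : ℝ :=
  if c = 1 / 2 then √(T * Real.log N)
  else min (Real.log N / (1 - 2 * c)) √(T * Real.log N)

end AbstentionGame

/-! Let `m = Nat.log 2 N`. Choose `m` disjoint blocks of `L` rounds, fill them with fair random
labels, and make all other labels `false`. In a block round any action costs at least `c` on average
(`le_sum_learnerLoss_round`). If the experts include all `2 ^ m` block-constant sequences, one of
them follows the majority in every block and loses `(L - |S|) / 2` there, where `S` is the block's
sum of signs. Since `E|S| ≥ 3/8 √(2L)` (`le_sum_abs_bits`), the mean regret is at least `m/2 (3/8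
√(2L) - (1 - 2c) L)`, and some labelling attains the mean (`exists_labels_le_expectedRegret`).

As `3/8 √2 > 1/2`, this is of order `m √L` once `(1 - 2c) √L ≤ 1/2`. Taking `L` near `min (T/m)
(1/(4 (1 - 2c)²))` gives the two terms of the rate (`exists_block_length`). -/

namespace AbstentionGame

/-! ### Moments of sums of random signs, written as sums over the cube. -/

section Rademacher

/-- The sign `±1` attached to a bit. -/
noncomputable def bitSign (b : Bool) : ℝ := if b then 1 else -1

lemma bitSign_not (b : Bool) : bitSign (!b) = -bitSign b := by
  cases b <;> simp [bitSign]

lemma bitSign_sq (b : Bool) : bitSign b ^ 2 = 1 := by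
  cases b <;> simp [bitSign]

variable {ι : Type*} [DecidableEq ι]

/-- Flip one coordinate of a bit vector. -/
def flipAt (i : ι) (z : ι → Bool) : ι → Bool := Function.update z i (!z i)

lemma flipAt_involutive (i : ι) : Function.Involutive (flipAt i) := by
  intro z
  simp [flipAt]

lemma sum_bits_flipAt_of_notMem {A : Finset ι} {i : ι} (hi : i ∉ A) (z : ι → Bool) :
    ∑ j ∈ A, bitSign (flipAt i z j) = ∑ j ∈ A, bitSign (z j) := by
  refine Finset.sum_congr rfl fun j hj => ?_
  have hji : j ≠ i := ne_of_mem_of_not_mem hj hi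
  rw [flipAt, Function.update_of_ne hji]

variable [Fintype ι]

lemma sum_flipAt (i : ι) (f : (ι → Bool) → ℝ) : ∑ z, f (flipAt i z) = ∑ z, f z :=
  Equiv.sum_comp (flipAt_involutive i).toPerm f

/-- Flipping bit `i` negates every term. This kills the odd cross terms in the moment recursions
below. -/
lemma sum_bitSign_mul_eq_zero {A : Finset ι} {i : ι} (hi : i ∉ A) (g : ℝ → ℝ) :
    ∑ z : ι → Bool, bitSign (z i) * g (∑ j ∈ A, bitSign (z j)) = 0 := by
  have h := sum_flipAt i fun z => bitSign (z i) * g (∑ j ∈ A, bitSign (z j))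
  simp only [sum_bits_flipAt_of_notMem hi] at h
  simp only [flipAt, Function.update_self, bitSign_not, neg_mul, Finset.sum_neg_distrib] at h
  linarith

lemma sum_sq_bits (A : Finset ι) :
    ∑ z : ι → Bool, (∑ j ∈ A, bitSign (z j)) ^ 2 = Fintype.card (ι → Bool) * (A.card : ℝ) := by
  induction A using Finset.induction_on with
  | empty => simp
  | insert i A hi ih =>
    have h : ∀ z : ι → Bool, (∑ j ∈ insert i A, bitSign (z j)) ^ 2
        = 1 + 2 * (bitSign (z i) * (∑ j ∈ A, bitSign (z j)))
          + (∑ j ∈ A, bitSign (z j)) ^ 2 := fun z => by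
      rw [Finset.sum_insert hi]
      linear_combination bitSign_sq (z i)
    have h0 := sum_bitSign_mul_eq_zero hi (fun x => x)
    simp only [h, Finset.sum_add_distrib, ← Finset.mul_sum, h0, ih, Finset.card_insert_of_notMem hi,
      Finset.sum_const, Finset.card_univ, nsmul_eq_mul]
    push_cast
    ring

lemma sum_pow_four_bits_le (A : Finset ι) :
    ∑ z : ι → Bool, (∑ j ∈ A, bitSign (z j)) ^ 4
      ≤ Fintype.card (ι → Bool) * (3 * (A.card : ℝ) ^ 2) := by
  induction A using Finset.induction_on with
  | empty => simp
  | insert i A hi ih =>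
    have h : ∀ z : ι → Bool, (∑ j ∈ insert i A, bitSign (z j)) ^ 4
        = 1 + 4 * (bitSign (z i) * (∑ j ∈ A, bitSign (z j)))
          + 6 * (∑ j ∈ A, bitSign (z j)) ^ 2
          + 4 * (bitSign (z i) * (∑ j ∈ A, bitSign (z j)) ^ 3)
          + (∑ j ∈ A, bitSign (z j)) ^ 4 := fun z => by
      rw [Finset.sum_insert hi]
      generalize ∑ j ∈ A, bitSign (z j) = s
      linear_combination (bitSign (z i) ^ 2 + 1 + 4 * bitSign (z i) * s + 6 * s ^ 2)
        * bitSign_sq (z i)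
    have h1 := sum_bitSign_mul_eq_zero hi (fun x => x)
    have h3 := sum_bitSign_mul_eq_zero hi (fun x => x ^ 3)
    simp only [h, Finset.sum_add_distrib, ← Finset.mul_sum, h1, h3, sum_sq_bits,
      Finset.card_insert_of_notMem hi, Finset.sum_const, Finset.card_univ, nsmul_eq_mul]
    push_cast
    have hK : (0 : ℝ) ≤ (Fintype.card (ι → Bool) : ℝ) := Nat.cast_nonneg _
    linarith

/-- A Khintchine inequality: the mean absolute value of a sum of `k` independent random signs
is at least `√(9k/32)`. -/
lemma le_sum_abs_bits {A : Finset ι} (hA : A.Nonempty) :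
    Fintype.card (ι → Bool) * (3 / 8 * √(2 * (A.card : ℝ)))
      ≤ ∑ z : ι → Bool, |∑ j ∈ A, bitSign (z j)| := by
  have hk : (0 : ℝ) < A.card := by exact_mod_cast hA.card_pos
  set k : ℝ := (A.card : ℝ)
  set σ := √(2 * k)
  have hσ : 0 < σ := Real.sqrt_pos.2 (by linarith)
  have hσ2 : σ ^ 2 = 2 * k := Real.sq_sqrt (by linarith)
  -- A minorant of `|x|` touching it at `0` and `±σ`, so that second and fourth moments suffice.
  -- With `σ² = 2k` its mean is at least `3σ/8`.
  have key : ∀ x : ℝ, 3 / (2 * σ) * x ^ 2 - 1 / (2 * σ ^ 3) * x ^ 4 ≤ |x| := fun x => by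
    have h0 := abs_nonneg x
    have h : 0 ≤ |x| * ((|x| - σ) ^ 2 * (|x| + 2 * σ)) / (2 * σ ^ 3) := by positivity
    have e : |x| * ((|x| - σ) ^ 2 * (|x| + 2 * σ)) / (2 * σ ^ 3)
        = |x| - (3 / (2 * σ) * |x| ^ 2 - 1 / (2 * σ ^ 3) * |x| ^ 4) := by
      field_simp
      ring
    rw [e, sq_abs, Even.pow_abs (by decide)] at h
    linarith
  have h2 := sum_sq_bits A
  have h4 := sum_pow_four_bits_le A
  calc _ = 3 / (2 * σ) * (Fintype.card (ι → Bool) * k)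
        - 1 / (2 * σ ^ 3) * (Fintype.card (ι → Bool) * (3 * k ^ 2)) := by
        have : k = σ ^ 2 / 2 := by linarith
        rw [this]
        field_simp
        ring
    _ ≤ 3 / (2 * σ) * (∑ z : ι → Bool, (∑ j ∈ A, bitSign (z j)) ^ 2)
        - 1 / (2 * σ ^ 3) * ∑ z : ι → Bool, (∑ j ∈ A, bitSign (z j)) ^ 4 := by
        rw [h2]
        gcongr
    _ = ∑ z : ι → Bool, (3 / (2 * σ) * (∑ j ∈ A, bitSign (z j)) ^ 2
        - 1 / (2 * σ ^ 3) * (∑ j ∈ A, bitSign (z j)) ^ 4) := by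
        rw [Finset.sum_sub_distrib, Finset.mul_sum, Finset.mul_sum]
    _ ≤ _ := Finset.sum_le_sum fun z _ => key _

end Rademacher

/-! ### Losses of single rounds and the regret against one expert. -/

section Losses

lemma binaryLoss_eq (b y : Bool) : binaryLoss b y = (1 - bitSign b * bitSign y) / 2 := by
  cases b <;> cases y <;> norm_num [binaryLoss, bitSign]

lemma learnerLoss_nonneg {c : ℝ} (hc : 0 ≤ c) (a : Action) (y : Bool) :
    0 ≤ learnerLoss c a y := by
  cases a with
  | label b => simp only [learnerLoss, binaryLoss]; split_ifs <;> norm_num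
  | abstain => exact hc

lemma learnerLoss_le_one {c : ℝ} (hc : c ≤ 1) (a : Action) (y : Bool) :
    learnerLoss c a y ≤ 1 := by
  cases a with
  | label b => simp only [learnerLoss, binaryLoss]; split_ifs <;> norm_num
  | abstain => exact hc

/-- Against a fair coin no action has a mean loss below `c`. -/
lemma two_mul_le_learnerLoss_add {c : ℝ} (hc : c ≤ 1 / 2) (a : Action) (y : Bool) :
    2 * c ≤ learnerLoss c a y + learnerLoss c a (!y) := by
  cases a with
  | label b => cases b <;> cases y <;> simp [learnerLoss, binaryLoss] <;> linarith
  | abstain => simp only [learnerLoss]; linarith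

variable {N T : ℕ} {Ω : Type*} [MeasurableSpace Ω] (P : Measure Ω) [IsProbabilityMeasure P]
  {c : ℝ} (S : RandomizedStrategy N T Ω) (experts : Fin N → Fin T → Bool)

lemma integrable_learnerLoss (hc0 : 0 ≤ c) (hc1 : c ≤ 1) (y : Fin T → Bool) (t : Fin T) :
    Integrable (fun ω => learnerLoss c (S.play experts y t ω) (y t)) P := by
  have hm : Measurable fun ω => learnerLoss c (S.play experts y t ω) (y t) :=
    (measurable_from_top (f := fun a : Action => learnerLoss c a (y t))).comp
      (S.measurable_act t _ _)
  refine Integrable.of_bound hm.aestronglyMeasurable 1 (ae_of_all _ fun ω => ?_)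
  rw [Real.norm_eq_abs, abs_of_nonneg (learnerLoss_nonneg hc0 _ _)]
  exact learnerLoss_le_one hc1 _ _

lemma sub_le_expectedRegret (hc0 : 0 ≤ c) (hc1 : c ≤ 1) (y : Fin T → Bool) (i : Fin N) :
    ∑ t, ∫ ω, learnerLoss c (S.play experts y t ω) (y t) ∂P - ∑ t, binaryLoss (experts i t) (y t)
      ≤ expectedRegret P c experts S y := by
  have hint := integrable_learnerLoss P S experts hc0 hc1 y
  refine le_trans (le_of_eq ?_) (le_ciSup (Set.finite_range _).bddAbove i)
  simp only [Finset.sum_sub_distrib]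
  rw [integral_sub (integrable_finsetSum _ fun t _ => hint t) (integrable_const _),
    integral_finsetSum _ fun t _ => hint t]
  simp

/-- The action of a round does not depend on the label of this round. -/
lemma play_congr {y y' : Fin T → Bool} {t : Fin T} (h : ∀ s < t, y s = y' s) (ω : Ω) :
    S.play experts y t ω = S.play experts y' t ω := by
  have : (fun s : Set.Iio t => y s) = fun s : Set.Iio t => y' s := funext fun s => h s s.2
  simp only [RandomizedStrategy.play, this]

end Losses

/-! ### Labels supported on a chosen set of rounds. -/

section Extension

variable {ι : Type*} {T : ℕ}

/-- The bit vector on `Fin T` that agrees with `z` along `e` and is `false` elsewhere. -/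
noncomputable def extendBits (e : ι ↪ Fin T) (z : ι → Bool) : Fin T → Bool :=
  Function.extend e z fun _ => false

@[simp] lemma extendBits_apply (e : ι ↪ Fin T) (z : ι → Bool) (p : ι) :
    extendBits e z (e p) = z p :=
  e.injective.extend_apply _ _ _

lemma extendBits_of_notMem (e : ι ↪ Fin T) (z : ι → Bool) {t : Fin T} (ht : t ∉ Set.range e) :
    extendBits e z t = false :=
  Function.extend_apply' _ _ _ fun h => ht h

lemma extendBits_flipAt [DecidableEq ι] (e : ι ↪ Fin T) (z : ι → Bool) (p : ι) {t : Fin T}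
    (ht : t ≠ e p) :
    extendBits e (flipAt p z) t = extendBits e z t := by
  by_cases h : t ∈ Set.range e
  · obtain ⟨q, rfl⟩ := h
    have : q ≠ p := fun h => ht (h ▸ rfl)
    simp [flipAt, this]
  · rw [extendBits_of_notMem e _ h, extendBits_of_notMem e _ h]

variable [Fintype ι]

/-- Outside the range of `e` both vectors are `false`, so no loss arises there. -/
lemma sum_binaryLoss_extendBits (e : ι ↪ Fin T) (x z : ι → Bool) :
    ∑ t, binaryLoss (extendBits e x t) (extendBits e z t) = ∑ p, binaryLoss (x p) (z p) := by
  have h := Finset.sum_subset (Finset.subset_univ (Finset.univ.map e))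
    (f := fun t => binaryLoss (extendBits e x t) (extendBits e z t)) fun t _ ht => by
      have ht' : t ∉ Set.range e := by simpa using ht
      simp [extendBits_of_notMem e _ ht', binaryLoss]
  rw [← h, Finset.sum_map]
  simp

variable [DecidableEq ι] {N : ℕ} {Ω : Type*} [MeasurableSpace Ω] (P : Measure Ω)
  [IsProbabilityMeasure P] {c : ℝ} (S : RandomizedStrategy N T Ω) (experts : Fin N → Fin T → Bool)

/-- Pair `z` with its flip at `p`: the learner cannot distinguish them before acting in round `e p`,
so the same action meets both labels. -/
lemma le_sum_learnerLoss_round (hc0 : 0 ≤ c) (hc : c ≤ 1 / 2) (e : ι ↪ Fin T) (p : ι) :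
    Fintype.card (ι → Bool) * c ≤ ∑ z : ι → Bool,
      ∫ ω, learnerLoss c (S.play experts (extendBits e z) (e p) ω) (z p) ∂P := by
  have hint (z : ι → Bool) :
      Integrable (fun ω => learnerLoss c (S.play experts (extendBits e z) (e p) ω) (z p)) P := by
    simpa using
      integrable_learnerLoss P S experts hc0 (by linarith : c ≤ 1) (extendBits e z) (e p)
  have hplay (z : ι → Bool) (ω : Ω) : S.play experts (extendBits e (flipAt p z)) (e p) ω
      = S.play experts (extendBits e z) (e p) ω :=
    play_congr S experts (fun s hs => extendBits_flipAt e z p hs.ne) ω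
  have hflip := sum_flipAt p fun z : ι → Bool =>
    ∫ ω, learnerLoss c (S.play experts (extendBits e z) (e p) ω) (z p) ∂P
  have hpair (z : ι → Bool) : 2 * c ≤
      (∫ ω, learnerLoss c (S.play experts (extendBits e z) (e p) ω) (z p) ∂P)
      + ∫ ω, learnerLoss c (S.play experts (extendBits e (flipAt p z)) (e p) ω)
          (flipAt p z p) ∂P := by
    rw [← integral_add (hint z) (hint (flipAt p z))]
    calc 2 * c = ∫ _, 2 * c ∂P := by simp
      _ ≤ _ := by
        refine integral_mono (integrable_const _) ((hint z).add (hint (flipAt p z))) fun ω => ?_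
        simp only [hplay]
        simp only [flipAt, Function.update_self]
        exact two_mul_le_learnerLoss_add hc _ _
  have hsum := Finset.sum_le_sum fun z (_ : z ∈ (Finset.univ : Finset (ι → Bool))) => hpair z
  rw [Finset.sum_add_distrib, hflip, Finset.sum_const, Finset.card_univ, nsmul_eq_mul] at hsum
  linarith

lemma le_sum_learnerLoss (hc0 : 0 ≤ c) (hc : c ≤ 1 / 2) (e : ι ↪ Fin T) :
    Fintype.card (ι → Bool) * (c * Fintype.card ι) ≤ ∑ z : ι → Bool,
      ∑ t, ∫ ω, learnerLoss c (S.play experts (extendBits e z) t ω) (extendBits e z t) ∂P := by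
  have hz (z : ι → Bool) :
      ∑ p, ∫ ω, learnerLoss c (S.play experts (extendBits e z) (e p) ω) (z p) ∂P
      ≤ ∑ t, ∫ ω, learnerLoss c (S.play experts (extendBits e z) t ω) (extendBits e z t) ∂P := by
    have h := Finset.sum_le_sum_of_subset_of_nonneg (Finset.subset_univ (Finset.univ.map e))
      (f := fun t =>
        ∫ ω, learnerLoss c (S.play experts (extendBits e z) t ω) (extendBits e z t) ∂P)
      fun t _ _ => integral_nonneg fun ω => learnerLoss_nonneg hc0 _ _
    simpa [Finset.sum_map] using h
  refine le_trans ?_ (Finset.sum_le_sum fun z _ => hz z)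
  rw [Finset.sum_comm]
  refine le_trans (le_of_eq ?_)
    (Finset.sum_le_sum fun p _ => le_sum_learnerLoss_round P S experts hc0 hc e p)
  rw [Finset.sum_const, Finset.card_univ, nsmul_eq_mul]
  ring

end Extension

/-! ### Block-constant experts and the averaged regret. -/

section Blocks

variable {m L T N : ℕ}

/-- The best block-constant prediction for the bits `z`. -/
lemma exists_sum_binaryLoss_eq (z : Fin m × Fin L → Bool) :
    -- The witness is the majority bit of each block.
    ∃ s : Fin m → Bool, ∑ p, binaryLoss (s p.1) (z p)
      = ∑ j, ((L : ℝ) - |∑ k, bitSign (z (j, k))|) / 2 := by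
  refine ⟨fun j => decide (0 ≤ ∑ k, bitSign (z (j, k))), ?_⟩
  rw [Fintype.sum_prod_type]
  refine Finset.sum_congr rfl fun j _ => ?_
  have key (b : Bool) : ∑ k, binaryLoss b (z (j, k))
      = (L - bitSign b * ∑ k, bitSign (z (j, k))) / 2 := by
    simp only [binaryLoss_eq, Finset.mul_sum]
    rw [← Finset.sum_div, Finset.sum_sub_distrib]
    simp
  dsimp only
  rw [key]
  generalize ∑ k, bitSign (z (j, k)) = x
  by_cases h : 0 ≤ x
  · simp [h, bitSign, abs_of_nonneg h]
  · simp [h, bitSign, abs_of_neg (not_le.1 h)]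

lemma le_sum_abs_block (hL : 0 < L) (j : Fin m) :
    Fintype.card (Fin m × Fin L → Bool) * (3 / 8 * √(2 * (L : ℝ)))
      ≤ ∑ z : Fin m × Fin L → Bool, |∑ k, bitSign (z (j, k))| := by
  let f : Fin L ↪ Fin m × Fin L := ⟨fun k => (j, k), fun _ _ h => (Prod.mk.inj h).2⟩
  have : NeZero L := ⟨hL.ne'⟩
  have h := le_sum_abs_bits (A := Finset.univ.map f) (Finset.univ_nonempty.map)
  simp only [Finset.sum_map, Finset.card_map, Finset.card_univ, Fintype.card_fin] at h
  exact h

/-- Distinct experts that include all block-constant ones. -/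
lemma exists_experts (hN : 2 ^ m ≤ N) (hT : N ≤ 2 ^ T) (e : Fin m × Fin L ↪ Fin T) :
    ∃ experts : Fin N → Fin T → Bool, Function.Injective experts ∧
      ∀ s : Fin m → Bool, ∃ i, experts i = extendBits e fun p => s p.1 := by
  classical
  have hA : (Finset.univ.image fun s : Fin m → Bool => extendBits e fun p => s p.1).card ≤ N :=
    Finset.card_image_le.trans (by simpa using hN)
  -- Padding to exactly `N` sequences is harmless: further experts can only raise the maximum
  -- defining the regret.
  obtain ⟨B, hAB, hB⟩ := Finset.exists_superset_card_eq hA (by simpa using hT)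
  refine ⟨fun i => (B.equivFinOfCardEq hB).symm i,
    Subtype.val_injective.comp (Equiv.injective _), fun s => ?_⟩
  have hs : (extendBits e fun p => s p.1) ∈ B :=
    hAB (Finset.mem_image_of_mem _ (Finset.mem_univ s))
  exact ⟨B.equivFinOfCardEq hB ⟨_, hs⟩, by simp⟩

lemma exists_labels_le_expectedRegret {Ω : Type*} [MeasurableSpace Ω] (P : Measure Ω)
    [IsProbabilityMeasure P] {c : ℝ} (hc0 : 0 ≤ c) (hc : c ≤ 1 / 2)
    (S : RandomizedStrategy N T Ω) {experts : Fin N → Fin T → Bool} (hL : 0 < L)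
    (e : Fin m × Fin L ↪ Fin T)
    (hexp : ∀ s : Fin m → Bool, ∃ i, experts i = extendBits e fun p => s p.1) :
    ∃ y : Fin T → Bool, m / 2 * (3 / 8 * √(2 * (L : ℝ)) - (1 - 2 * c) * L)
      ≤ expectedRegret P c experts S y := by
  have hz (z : Fin m × Fin L → Bool) :
      ∑ t, ∫ ω, learnerLoss c (S.play experts (extendBits e z) t ω) (extendBits e z t) ∂P
        - ∑ j, ((L : ℝ) - |∑ k, bitSign (z (j, k))|) / 2
        ≤ expectedRegret P c experts S (extendBits e z) := by
    obtain ⟨s, hs⟩ := exists_sum_binaryLoss_eq z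
    obtain ⟨i, hi⟩ := hexp s
    have h := sub_le_expectedRegret P S experts hc0 (by linarith : c ≤ 1) (extendBits e z) i
    rwa [hi, sum_binaryLoss_extendBits, hs] at h
  have hlearn := le_sum_learnerLoss P S experts hc0 hc e
  have habs := Finset.sum_le_sum fun j (_ : j ∈ (Finset.univ : Finset (Fin m))) =>
    le_sum_abs_block hL j
  rw [Finset.sum_comm, Finset.sum_const, Finset.card_univ, nsmul_eq_mul, Fintype.card_fin] at habs
  have hsum := Finset.sum_le_sum
    fun z (_ : z ∈ (Finset.univ : Finset (Fin m × Fin L → Bool))) => hz z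
  simp only [Finset.sum_sub_distrib, ← Finset.sum_div, Finset.sum_const, Finset.card_univ,
    nsmul_eq_mul, Fintype.card_fin] at hsum
  simp only [Fintype.card_prod, Fintype.card_fin, Nat.cast_mul] at hlearn
  obtain ⟨z, -, hz⟩ := Finset.exists_le_of_sum_le
    (s := (Finset.univ : Finset (Fin m × Fin L → Bool)))
    (f := fun _ => m / 2 * (3 / 8 * √(2 * (L : ℝ)) - (1 - 2 * c) * L))
    (g := fun z => expectedRegret P c experts S (extendBits e z)) Finset.univ_nonempty (by
      rw [Finset.sum_const, Finset.card_univ, nsmul_eq_mul]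
      linarith)
  exact ⟨_, hz⟩

end Blocks

/-! ### Choice of the block length. -/

section Parameters

lemma half_le_floor {x : ℝ} (hx : 1 ≤ x) : x / 2 ≤ ⌊x⌋₊ := by
  have h1 : (1 : ℝ) ≤ ⌊x⌋₊ := by exact_mod_cast Nat.le_floor (by simpa using hx)
  linarith [Nat.lt_floor_add_one x]

lemma log_le_two_mul_natLog {N : ℕ} (hN : 2 ≤ N) : Real.log N ≤ 2 * (Nat.log 2 N : ℕ) := by
  have hm : 1 ≤ Nat.log 2 N := Nat.log_pos one_lt_two hN
  have h : (N : ℝ) ≤ 2 ^ (Nat.log 2 N + 1) := by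
    exact_mod_cast (Nat.lt_pow_succ_log_self one_lt_two N).le
  have h' := Real.log_le_log (by positivity) h
  rw [Real.log_pow] at h'
  have hm' : (1 : ℝ) ≤ (Nat.log 2 N : ℕ) := by exact_mod_cast hm
  have := Real.log_two_lt_d9
  push_cast at h'
  nlinarith

lemma natLog_le_two_mul_log {N : ℕ} (hN : 2 ≤ N) : (Nat.log 2 N : ℕ) ≤ 2 * Real.log N := by
  have h : (2 : ℝ) ^ (Nat.log 2 N) ≤ N := by
    exact_mod_cast Nat.pow_log_le_self 2 (by omega)
  have h' := Real.log_le_log (by positivity) h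
  rw [Real.log_pow] at h'
  have := Real.log_two_gt_d9
  have h0 : (0 : ℝ) ≤ (Nat.log 2 N : ℕ) := Nat.cast_nonneg _
  nlinarith

/-- The block length. -/
lemma exists_block_length {c : ℝ} {N T : ℕ} (hc : c ∈ Set.Icc (1 / 4 : ℝ) (1 / 2)) (hN : 2 ≤ N)
    (hT : 4 * Real.log N ≤ T) :
    ∃ L : ℕ, 0 < L ∧ Nat.log 2 N * L ≤ T ∧ (1 - 2 * c) * √L ≤ 1 / 2 ∧
      rate c N T ≤ 8 * ((Nat.log 2 N : ℕ) * √L) := by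
  obtain ⟨hc1, hc2⟩ := hc
  have hlog := log_le_two_mul_natLog hN
  have hlog' := natLog_le_two_mul_log hN
  have hm1 : (1 : ℝ) ≤ (Nat.log 2 N : ℕ) := by exact_mod_cast Nat.log_pos one_lt_two hN
  generalize Nat.log 2 N = m at *
  set δ := 1 - 2 * c with hδ
  have hm0 : (0 : ℝ) < m := by linarith
  -- This decides whether `T/m` or `1/(4δ²)` is the smaller bound on `L`. The case `c = 1/2` falls
  -- in the first branch.
  by_cases hcase : 4 * δ ^ 2 * T ≤ m
  · have hx : (1 : ℝ) ≤ T / m := by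
      rw [le_div_iff₀ hm0]
      linarith
    have hfl : (⌊(T : ℝ) / m⌋₊ : ℝ) ≤ T / m := Nat.floor_le (by positivity)
    have hhalf := half_le_floor hx
    have hpos : 0 < ⌊(T : ℝ) / m⌋₊ := Nat.floor_pos.2 hx
    generalize ⌊(T : ℝ) / m⌋₊ = L at *
    have hmL : (m : ℝ) * L ≤ T := by
      rw [le_div_iff₀ hm0] at hfl
      linarith
    refine ⟨L, hpos, by exact_mod_cast hmL, ?_, ?_⟩
    · refine abs_le_of_sq_le_sq' ?_ (by norm_num) |>.2
      rw [mul_pow, Real.sq_sqrt (Nat.cast_nonneg _)]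
      nlinarith [sq_nonneg δ, mul_le_mul_of_nonneg_left hmL (sq_nonneg δ)]
    · have hr : rate c N T ≤ √(T * Real.log N) := by
        unfold rate
        split_ifs
        · exact le_rfl
        · exact min_le_right _ _
      refine hr.trans (Real.sqrt_le_left (by positivity) |>.2 ?_)
      rw [mul_pow, mul_pow, Real.sq_sqrt (Nat.cast_nonneg _)]
      have hT2 : (T : ℝ) ≤ 2 * (m * L) := by
        rw [div_div, div_le_iff₀ (by positivity)] at hhalf
        linarith
      calc (T : ℝ) * Real.log N ≤ T * (2 * m) := by gcongr
        _ ≤ 2 * (m * L) * (2 * m) := by gcongr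
        _ ≤ 8 ^ 2 * ((m : ℝ) ^ 2 * L) := by
          have : (0 : ℝ) ≤ (m : ℝ) ^ 2 * L := by positivity
          linarith
  · have hδ0 : 0 < δ := by
      refine lt_of_le_of_ne (by linarith) fun h => hcase ?_
      rw [← h]
      simp
    have hδ1 : δ ≤ 1 / 2 := by linarith
    have hx : (1 : ℝ) ≤ 1 / (4 * δ ^ 2) := by
      rw [le_div_iff₀ (by positivity)]
      nlinarith
    have hfl : (⌊1 / (4 * δ ^ 2)⌋₊ : ℝ) ≤ 1 / (4 * δ ^ 2) := Nat.floor_le (by positivity)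
    have hhalf := half_le_floor hx
    have hpos : 0 < ⌊1 / (4 * δ ^ 2)⌋₊ := Nat.floor_pos.2 hx
    generalize ⌊1 / (4 * δ ^ 2)⌋₊ = L at *
    rw [le_div_iff₀ (by positivity)] at hfl
    rw [div_div, div_le_iff₀ (by positivity)] at hhalf
    have hmL : (m : ℝ) * L ≤ T := by
      have h1 : δ ^ 2 * (4 * (m * L)) ≤ δ ^ 2 * (4 * T) := by nlinarith
      have := le_of_mul_le_mul_left h1 (by positivity)
      linarith
    refine ⟨L, hpos, by exact_mod_cast hmL, ?_, ?_⟩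
    · refine abs_le_of_sq_le_sq' ?_ (by norm_num) |>.2
      rw [mul_pow, Real.sq_sqrt (Nat.cast_nonneg _)]
      linarith
    · have hr : rate c N T ≤ Real.log N / δ := by
        unfold rate
        rw [if_neg (by intro h; rw [h] at hδ; norm_num at hδ; linarith)]
        exact min_le_left _ _
      -- Rounding down at most halves, so `L ≥ 1/(8δ²)`. Together with `log N ≤ 2m` this yields the
      -- factor `8`.
      have hs : 1 ≤ 4 * (√L * δ) := by
        refine abs_le_of_sq_le_sq' ?_ (by positivity) |>.2
        rw [mul_pow, mul_pow, Real.sq_sqrt (Nat.cast_nonneg _)]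
        linarith
      refine hr.trans ?_
      rw [div_le_iff₀ hδ0]
      nlinarith

lemma le_two_pow_of_log_le {N T : ℕ} (hN : 2 ≤ N) (hT : 4 * Real.log N ≤ T) : N ≤ 2 ^ T := by
  have hN0 : (0 : ℝ) < N := by positivity
  have hlog : 0 ≤ Real.log N := Real.log_natCast_nonneg N
  have h : Real.log N ≤ Real.log (2 ^ T) := by
    rw [Real.log_pow]
    have := Real.log_two_gt_d9
    have : (0 : ℝ) ≤ T := Nat.cast_nonneg _
    nlinarith
  exact_mod_cast (Real.log_le_log_iff hN0 (by positivity)).1 h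

end Parameters

end AbstentionGame

open AbstentionGame in
theorem mainTheorem3 :
    ∃ C : ℝ, 0 < C ∧
      ∀ (c : ℝ) (N T : ℕ), c ∈ Set.Icc (1 / 4 : ℝ) (1 / 2) → 2 ≤ N → 4 * Real.log N ≤ T →
        ∃ experts : Fin N → Fin T → Bool, Function.Injective experts ∧
          ∀ (Ω : Type*) [MeasurableSpace Ω] (P : Measure Ω) [IsProbabilityMeasure P]
            (S : AbstentionGame.RandomizedStrategy N T Ω),
            ∃ y : Fin T → Bool,
              C * AbstentionGame.rate c N T ≤ AbstentionGame.expectedRegret P c experts S y := by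
  -- Any constant up to `0.02 / (2 * 8)` would pass the final estimate.
  refine ⟨1 / 1000, by norm_num, fun c N T hc hN hT => ?_⟩
  obtain ⟨L, hL, hmL, hδ, hrate⟩ := exists_block_length hc hN hT
  obtain ⟨e⟩ : Nonempty (Fin (Nat.log 2 N) × Fin L ↪ Fin T) :=
    Function.Embedding.nonempty_of_card_le (by simpa using hmL)
  obtain ⟨experts, hinj, hexp⟩ :=
    exists_experts (Nat.pow_log_le_self 2 (by omega)) (le_two_pow_of_log_le hN hT) e
  refine ⟨experts, hinj, fun Ω _ P _ S => ?_⟩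
  obtain ⟨y, hy⟩ := exists_labels_le_expectedRegret P (by linarith [hc.1]) hc.2 S hL e hexp
  refine ⟨y, le_trans ?_ hy⟩
  have h2 : (1.41 : ℝ) ≤ √2 := Real.le_sqrt_of_sq_le (by norm_num)
  have hs : √(L : ℝ) * √L = L := Real.mul_self_sqrt (Nat.cast_nonneg _)
  have hs0 : 0 ≤ √(L : ℝ) := Real.sqrt_nonneg _
  -- `3/8 * 1.41 > 0.52`, whereas the abstention term takes at most `1/2`.
  have hgap : 0.02 * √(L : ℝ) ≤ 3 / 8 * √(2 * (L : ℝ)) - (1 - 2 * c) * L := by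
    rw [Real.sqrt_mul (by norm_num)]
    have e1 : (1 - 2 * c) * (L : ℝ) = (1 - 2 * c) * √L * √L := by rw [mul_assoc, hs]
    rw [e1]
    nlinarith [mul_le_mul_of_nonneg_right hδ hs0, mul_le_mul_of_nonneg_right h2 hs0]
  calc 1 / 1000 * rate c N T ≤ 1 / 1000 * (8 * ((Nat.log 2 N : ℕ) * √L)) := by gcongr
    _ ≤ (Nat.log 2 N : ℕ) / 2 * (0.02 * √(L : ℝ)) := by
      have : (0 : ℝ) ≤ (Nat.log 2 N : ℕ) * √L := by positivity
      linarith
    _ ≤ _ := by gcongr
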